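/- Throughout, an Ahlfors regular space of dimension $d>0$ is a metric space $X$ with at least two points, together with a Borel measure $\mu$, such that for some constant $C>0$ one has $C^{-1}r^d\le\mu(B(x,r))\le C\,r^d$ for all $x\in X$ and all real $0<r\le\operatorname{diam}(X)\le\infty$, where $B(x,r)$ is the open ball. For $s>0$ and a subset $E$ of a metric space let $$\mathcal H^s_\infty(E)=\inf\Big\{\sum_{n}\operatorname{diam}(E_n)^s: E\subset\bigcup_{n}E_n\Big\}$$ (countable covers by arbitrary sets) be its Hausdorff content. Let $\mathcal G^s(X)$ be the class of all $G_\delta$ sets $F\subset X$ for which there is a constant $0<c\le1$ such that $\mathcal H^s_\infty(F\cap U)\ge c\,\mathcal H^s_\infty(U)$ for every open set $U\subset X$. **Theorem.** Let $X$ be an Ahlfors regular space of dimension $d$ and let $0<s\le d$. Then: (i) $\dim_{\mathcal H}F\ge s$ for every $F\in\mathcal G^s(X)$. (ii) If $F\in\mathcal G^s(X)$ and $F\subset E\subset X$, where $E$ is a $G_\delta$ set, then $E\in\mathcal G^s(X)$. (iii) If $0<t\le s$, then $\mathcal G^s(X)\subset\mathcal G^t(X)$. (iv) If $X$ is complete,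 then the intersection of every countable family of members of $\mathcal G^s(X)$ belongs to $\mathcal G^s(X)$. (v) If $Y$ is another Ahlfors regular space (of some dimension) and $f:X\to Y$ is a bi-Lipschitz homeomorphism, then for every $F\subset X$ one has $F\in\mathcal G^s(X)$ if and only if $f(F)\in\mathcal G^s(Y)$. (vi) If $Y$ is another Ahlfors regular space, of dimension $e$, and $0<t\le e$, then $F\times G\in\mathcal G^{s+t}(X\times Y)$ for all $F\in\mathcal G^s(X)$ and $G\in\mathcal G^t(Y)$, where $X\times Y$ carries the product (maximum) distance. -/

import Mathlib

open MeasureTheory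
open scoped ENNReal

noncomputable section

/-- The Hausdorff content `H^s_∞(E)`: the infimum of `∑ diam(A_n)^s` over all countable covers
`(A_n)` of `E` by arbitrary sets. It is used for `s > 0` only, so that empty sets in a cover
contribute `0`. -/
def hausdorffContent {X : Type*} [MetricSpace X] (s : ℝ) (E : Set X) : ℝ≥0∞ :=
  ⨅ (A : ℕ → Set X) (_ : E ⊆ ⋃ n, A n), ∑' n, Metric.ediam (A n) ^ s

/-- The class `G^s(X)`: the `G_δ` sets `F ⊆ X` for which there is `0 < c ≤ 1` such that
`H^s_∞(F ∩ U) ≥ c H^s_∞(U)` for every open set `U`. -/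
def GClass (X : Type*) [MetricSpace X] (s : ℝ) : Set (Set X) :=
  {F | IsGδ F ∧ ∃ c : ℝ, 0 < c ∧ c ≤ 1 ∧ ∀ U : Set X, IsOpen U →
    ENNReal.ofReal c * hausdorffContent s U ≤ hausdorffContent s (F ∩ U)}

/-- Ahlfors regularity of dimension `d` of the Borel measure `μ`: there is `C > 0` such that
`C⁻¹ r^d ≤ μ(B(x,r)) ≤ C r^d` for all points `x` and all real `0 < r ≤ diam X`
(open balls; the diameter may be infinite). -/
def IsAhlforsRegular {X : Type*} [MetricSpace X] [MeasurableSpace X] [BorelSpace X]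
    (μ : Measure X) (d : ℝ) : Prop :=
  0 < d ∧ ∃ C : ℝ, 0 < C ∧ ∀ (x : X) (r : ℝ), 0 < r →
    ENNReal.ofReal r ≤ Metric.ediam (Set.univ : Set X) →
      ENNReal.ofReal (C⁻¹ * r ^ d) ≤ μ (Metric.ball x r) ∧
        μ (Metric.ball x r) ≤ ENNReal.ofReal (C * r ^ d)

end

/-!
# Permanence properties of the classes `GClass X s`

The link between the global definition of `GClass` and local information is `LowerContentBound`:
the content of `F` inside every small ball of radius `ρ` is at least `c * ρ ^ s`. On an Ahlfors
regular space every member of `GClass X s` has this property, by the mass distribution principle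
(`AhlforsUpTo.exists_lowerContentBound`). Conversely, on any metric space, a `G_δ` set with this
property belongs to `GClass X t` for all `t ≤ s` (`LowerContentBound.mem_GClass`): given a cover of
`F ∩ U`, a point of the open set `U` is either close to a piece of the cover that is large
compared to its distance, or is the centre of a ball in `U` that touches only smaller pieces, whose
total mass is then at least comparable to that of the ball; Vitali's covering theorem, in the form of
the maximal function estimate `hausdorffContent_le_measure`, turns this into a cover of `U`.
The dimension bound and the inclusions between the classes follow at once. Only
small scales matter, so that no assumption on the geometry of `X` at the scale of its
diameter is needed, and products of spaces of different diameters cause no difficulty.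

For products, a cover of `A ×ˢ B`, sliced over the points of `A`, is a weighted cover of `A`, and weighted
covers are as good as ordinary ones up to a constant (`mul_hausdorffContent_le_of_weighted`),
by a greedy version of Frostman's lemma valid in every metric space.

For countable intersections one may assume the sets to be open. If `s = d`, open members of the
class have full measure. If `s < d` and `X` is complete, suppose that `⋂ k, G k` had a cover in
some ball of mass much smaller than `ρ ^ s`. Since `s < d`, passing to a random much smaller ball
makes the normalized mass of the cover near the ball as small as desired; the content bound for
`G k` then yields a ball inside `G k` with normalized mass below the original threshold.
Iterating as in Baire's theorem leads to a point of the intersection that is not covered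
(`AhlforsUpTo.lowerContentBound_iInter_of_lt`). The threshold depends only on the constants of `X`, so
that the possible decay of the constants of the sets `G k` is harmless.
-/

open Metric Set

/-! ### Elementary properties of the Hausdorff content -/

theorem hausdorffContent_mono {X : Type*} [MetricSpace X] {s : ℝ} {E F : Set X} (h : E ⊆ F) :
    hausdorffContent s E ≤ hausdorffContent s F :=
  le_iInf₂ fun A hA => iInf₂_le A (h.trans hA)

/-- The content is bounded by covers indexed by an arbitrary countable type. -/
theorem hausdorffContent_le_tsum {X ι : Type*} [MetricSpace X] [Countable ι] {s : ℝ} (hs : 0 < s)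
    {E : Set X} (A : ι → Set X) (hA : E ⊆ ⋃ i, A i) :
    hausdorffContent s E ≤ ∑' i, ediam (A i) ^ s := by
  have := Encodable.ofCountable ι
  rw [← tsum_iUnion_decode₂ (fun B : Set X => ediam B ^ s) (by simp [hs]) A]
  exact iInf₂_le _ (by rwa [Encodable.iUnion_decode₂])

theorem hausdorffContent_le_tsum_closedBall {X ι : Type*} [MetricSpace X] [Countable ι] {s : ℝ}
    (hs : 0 < s) {E : Set X} (p : ι → X) (r : ι → ℝ) (hr : ∀ i, 0 ≤ r i)
    (hE : E ⊆ ⋃ i, closedBall (p i) (r i)) :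
    hausdorffContent s E ≤ ∑' i, ENNReal.ofReal ((2 * r i) ^ s) := by
  refine (hausdorffContent_le_tsum hs _ hE).trans (ENNReal.tsum_le_tsum fun i => ?_)
  rw [← ENNReal.ofReal_rpow_of_nonneg (by linarith [hr i]) hs.le]
  refine ENNReal.rpow_le_rpow (ediam_le_of_forall_dist_le fun x hx y hy => ?_) hs.le
  linarith [dist_triangle_right x y (p i), mem_closedBall.1 hx, mem_closedBall.1 hy]

/-- A set of small content has an efficient cover by closed balls of positive radii. The radii
exceed the diameters of the covering sets slightly, which disposes of sets of diameter zero. -/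
theorem exists_closedBall_cover {X : Type*} [MetricSpace X] [Nonempty X] {s : ℝ} (hs : 0 < s)
    {E : Set X} {L : ℝ≥0∞} (h : hausdorffContent s E < L) :
    ∃ (p : ℕ → X) (r : ℕ → ℝ), (∀ i, 0 < r i) ∧ E ⊆ ⋃ i, closedBall (p i) (r i) ∧
      ∑' i, ENNReal.ofReal (r i ^ s) < L := by
  simp only [hausdorffContent, iInf_lt_iff] at h
  obtain ⟨A, hA, hL⟩ := h
  have hfin : ∑' n, ediam (A n) ^ s ≠ ∞ := hL.ne_top
  have hd : ∀ n, ediam (A n) ≠ ∞ := fun n h' =>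
    ENNReal.ne_top_of_tsum_ne_top hfin n (by simp [h', hs])
  obtain ⟨ε, hε0, hε⟩ := ENNReal.exists_pos_sum_of_countable'
    (tsub_pos_iff_lt.2 hL).ne' ℕ
  have hεt : ∀ n, ε n ≠ ∞ := ENNReal.ne_top_of_tsum_ne_top hε.ne_top
  have hp : ∀ n, ∃ x, A n ⊆ closedBall x (diam (A n)) := by
    intro n
    rcases (A n).eq_empty_or_nonempty with h0 | ⟨x, hx⟩
    · exact ⟨Classical.arbitrary X, by simp [h0]⟩
    · exact ⟨x, fun y hy => dist_le_diam_of_mem' (hd n) hy hx⟩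
  choose p hp using hp
  have hpos : ∀ n, 0 < diam (A n) ^ s + (ε n).toReal := fun n =>
    add_pos_of_nonneg_of_pos (Real.rpow_nonneg diam_nonneg _)
      (ENNReal.toReal_pos (hε0 n).ne' (hεt n))
  refine ⟨p, fun n => (diam (A n) ^ s + (ε n).toReal) ^ s⁻¹,
    fun n => Real.rpow_pos_of_pos (hpos n) _, hA.trans (iUnion_mono fun n => (hp n).trans
      (closedBall_subset_closedBall ?_)), ?_⟩
  · conv_lhs => rw [← Real.rpow_rpow_inv (diam_nonneg (s := A n)) hs.ne']
    exact Real.rpow_le_rpow (Real.rpow_nonneg diam_nonneg _) (by simp) (by positivity)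
  · have : ∀ n, ENNReal.ofReal (((diam (A n) ^ s + (ε n).toReal) ^ s⁻¹) ^ s)
        = ediam (A n) ^ s + ε n := by
      intro n
      rw [Real.rpow_inv_rpow (hpos n).le hs.ne',
        ENNReal.ofReal_add (Real.rpow_nonneg diam_nonneg _) ENNReal.toReal_nonneg,
        ENNReal.ofReal_toReal (hεt n), ← ENNReal.ofReal_rpow_of_nonneg diam_nonneg hs.le]
      simp [diam, ENNReal.ofReal_toReal (hd n)]
    simp only [this]
    rw [ENNReal.tsum_add]
    calc _ < ∑' n, ediam (A n) ^ s + (L - ∑' n, ediam (A n) ^ s) :=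
          ENNReal.add_lt_add_left hfin hε
      _ = L := add_tsub_cancel_of_le hL.le

/-- Membership in `GClass` only needs the comparison of contents up to some positive factor. -/
theorem mem_GClass_of_le {X : Type*} [MetricSpace X] {s K : ℝ} {F : Set X} (hF : IsGδ F)
    (h : ∀ U : Set X, IsOpen U →
      hausdorffContent s U ≤ ENNReal.ofReal K * hausdorffContent s (F ∩ U)) :
    F ∈ GClass X s := by
  have hK : 0 < max K 1 := by positivity
  refine ⟨hF, (max K 1)⁻¹, by positivity, inv_le_one_of_one_le₀ (le_max_right _ _),
    fun U hU => ?_⟩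
  rw [ENNReal.ofReal_inv_of_pos hK]
  refine ENNReal.inv_mul_le_iff (by simp) ENNReal.ofReal_ne_top |>.2 ((h U hU).trans ?_)
  gcongr
  exact le_max_left _ _

theorem hausdorffContent_le_of_mem_GClass {X : Type*} [MetricSpace X] {s : ℝ} {F : Set X}
    (hF : F ∈ GClass X s) : ∃ K : ℝ, 0 < K ∧ ∀ U : Set X, IsOpen U →
      hausdorffContent s U ≤ ENNReal.ofReal K * hausdorffContent s (F ∩ U) := by
  obtain ⟨-, c, hc, -, h⟩ := hF
  refine ⟨c⁻¹, by positivity, fun U hU => ?_⟩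
  rw [ENNReal.ofReal_inv_of_pos hc]
  have := h U hU
  rw [mul_comm, ← div_eq_mul_inv]
  rw [ENNReal.le_div_iff_mul_le (by simp [hc]) (by simp), mul_comm]
  exact this

theorem GClass_superset {X : Type*} [MetricSpace X] {s : ℝ} {F E : Set X} (hF : F ∈ GClass X s)
    (hFE : F ⊆ E) (hE : IsGδ E) : E ∈ GClass X s := by
  obtain ⟨-, c, hc, hc1, h⟩ := hF
  exact ⟨hE, c, hc, hc1, fun U hU => (h U hU).trans
    (hausdorffContent_mono (inter_subset_inter_left _ hFE))⟩

/-! ### Covering theorems -/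

/-- A maximal function estimate: if every point of `A` lies in a ball of radius `R` whose
`m`-measure is at least comparable to `R ^ s`, then the content of `A` is controlled by the total
mass of `m`. -/
theorem hausdorffContent_le_measure {X : Type*} [MetricSpace X] [MeasurableSpace X]
    [OpensMeasurableSpace X] (m : Measure X) {s K : ℝ} (hs : 0 < s) (hK : 0 < K) {A : Set X}
    (h : ∀ x ∈ A, ∃ z R, 0 < R ∧ x ∈ closedBall z R ∧
      ENNReal.ofReal (R ^ s) ≤ ENNReal.ofReal K * m (closedBall z R)) :
    hausdorffContent s A ≤ ENNReal.ofReal (10 ^ s * K) * m univ := by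
  by_cases hm : m univ = ∞
  · rw [hm, ENNReal.mul_top (by simp; positivity)]
    exact le_top
  have hfin : IsFiniteMeasure m := ⟨lt_top_iff_ne_top.2 hm⟩
  choose! z R hR hxz hRm using h
  have hbd : ∀ x ∈ A, R x ≤ (K * m.real univ) ^ s⁻¹ := by
    intro x hx
    rw [Real.le_rpow_inv_iff_of_pos (hR x hx).le (by positivity) hs]
    have h1 : ENNReal.ofReal (R x ^ s) ≤ ENNReal.ofReal (K * m.real univ) := by
      rw [ENNReal.ofReal_mul hK.le, ofReal_measureReal]
      exact (hRm x hx).trans (by gcongr; exact subset_univ _)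
    exact (ENNReal.ofReal_le_ofReal_iff (by positivity)).1 h1
  obtain ⟨u, huA, hdisj, hcov⟩ := Vitali.exists_disjoint_subfamily_covering_enlargement_closedBall
    A z R _ hbd 5 (by norm_num)
  have hsum : ∑' b : u, ENNReal.ofReal (R b ^ s) ≤ ENNReal.ofReal K * m univ := by
    calc ∑' b : u, ENNReal.ofReal (R b ^ s)
        ≤ ∑' b : u, ENNReal.ofReal K * m (closedBall (z b) (R b)) :=
          ENNReal.tsum_le_tsum fun b => hRm b (huA b.2)
      _ = ENNReal.ofReal K * ∑' b : u, m (closedBall (z b) (R b)) := ENNReal.tsum_mul_left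
      _ ≤ ENNReal.ofReal K * m univ := by
          gcongr
          refine (tsum_meas_le_meas_iUnion_of_disjoint m
            (fun b : u => measurableSet_closedBall) ?_).trans (measure_mono (subset_univ _))
          exact fun a b hab => hdisj a.2 b.2 (fun h => hab (Subtype.ext h))
  have hcount : Countable u := by
    have h1 := Summable.countable_support_ennreal
      (hsum.trans_lt (ENNReal.mul_lt_top (by simp) (lt_top_iff_ne_top.2 hm))).ne
    have h2 : Function.support (fun b : u => ENNReal.ofReal (R b ^ s)) = univ := by
      ext b
      simpa using Real.rpow_pos_of_pos (hR b (huA b.2)) s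
    rw [h2] at h1
    exact countable_univ_iff.1 h1
  have hR0 : ∀ b : u, 0 ≤ R b := fun b => (hR b (huA b.2)).le
  calc hausdorffContent s A
      ≤ ∑' b : u, ENNReal.ofReal ((2 * (5 * R b)) ^ s) := by
        refine hausdorffContent_le_tsum_closedBall hs (fun b : u => z b) (fun b : u => 5 * R b)
          (fun b => by linarith [hR0 b]) fun x hx => ?_
        obtain ⟨b, hb, hsub⟩ := hcov x hx
        exact mem_iUnion.2 ⟨⟨b, hb⟩, hsub (hxz x hx)⟩
    _ = ENNReal.ofReal (10 ^ s) * ∑' b : u, ENNReal.ofReal (R b ^ s) := by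
        rw [← ENNReal.tsum_mul_left]
        congr with b
        rw [← ENNReal.ofReal_mul (by positivity), ← Real.mul_rpow (by norm_num) (hR0 b)]
        ring_nf
    _ ≤ ENNReal.ofReal (10 ^ s) * (ENNReal.ofReal K * m univ) := by gcongr
    _ = _ := by rw [← mul_assoc, ← ENNReal.ofReal_mul (by positivity)]

/-- The discrete form of `hausdorffContent_le_measure`: point masses `a j` at the points `p j`. -/
theorem hausdorffContent_le_tsum_of_indicator {X ι : Type*} [MetricSpace X] (p : ι → X)
    (a : ι → ℝ≥0∞) {s K : ℝ} (hs : 0 < s) (hK : 0 < K) {A : Set X}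
    (h : ∀ x ∈ A, ∃ z R, 0 < R ∧ x ∈ closedBall z R ∧ ENNReal.ofReal (R ^ s) ≤
      ENNReal.ofReal K * ∑' j, {j | p j ∈ closedBall z R}.indicator a j) :
    hausdorffContent s A ≤ ENNReal.ofReal (10 ^ s * K) * ∑' j, a j := by
  borelize X
  have key := hausdorffContent_le_measure (Measure.sum fun j => a j • Measure.dirac (p j)) hs hK
    (A := A) fun x hx => ?_
  · simpa [Measure.sum_apply] using key
  · obtain ⟨z, R, hR, hxz, hle⟩ := h x hx
    refine ⟨z, R, hR, hxz, hle.trans_eq ?_⟩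
    rw [Measure.sum_apply _ measurableSet_closedBall]
    congr 2 with j
    by_cases hj : p j ∈ closedBall z R
    · rw [Set.indicator_of_mem (show j ∈ {j | p j ∈ closedBall z R} from hj)]
      rw [Measure.smul_apply, Measure.dirac_apply' _ measurableSet_closedBall]
      simp [Set.indicator_of_mem hj]
    · rw [Set.indicator_of_notMem (show j ∉ {j | p j ∈ closedBall z R} from hj)]
      rw [Measure.smul_apply, Measure.dirac_apply' _ measurableSet_closedBall]
      simp [Set.indicator_of_notMem hj]

/-- The sum of `r i ^ s` over those balls `closedBall (p i) (r i)` that touch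
`closedBall z ρ`, in the formal sense that the centres are at distance at most `r i + ρ`. -/
noncomputable def touchingSum {X ι : Type*} [MetricSpace X] (s : ℝ) (p : ι → X) (r : ι → ℝ)
    (z : X) (ρ : ℝ) : ℝ≥0∞ :=
  ∑' i, {i | dist z (p i) ≤ r i + ρ}.indicator (fun i => ENNReal.ofReal (r i ^ s)) i

/-- If around every point of `A` there is a scale `ρ` at which the touching balls have
`s`-dimensional mass at least `κ * ρ ^ s`, then for every `t ≤ s` the whole family of balls controls
the `t`-content of `A`. A point lies either in the threefold enlargement of one of the balls, or
else all balls touching at scale `ρ` are smaller than `ρ`, so that lowering the exponent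
from `s` to `t` only helps. -/
theorem hausdorffContent_le_of_touchingSum {X ι : Type*} [MetricSpace X] {s t κ : ℝ} (ht : 0 < t)
    (hts : t ≤ s) (hκ : 0 < κ) (p : ι → X) (r : ι → ℝ) (hr : ∀ i, 0 < r i) {A : Set X}
    (h : ∀ z ∈ A, ∃ ρ, 0 < ρ ∧ ENNReal.ofReal (κ * ρ ^ s) ≤ touchingSum s p r z ρ) :
    hausdorffContent t A ≤ ENNReal.ofReal (10 ^ t * max (3 ^ t) (2 ^ t / κ)) *
      ∑' i, ENNReal.ofReal (r i ^ t) := by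
  refine hausdorffContent_le_tsum_of_indicator p _ ht (by positivity) fun x hx => ?_
  by_cases hnear : ∃ i, dist x (p i) ≤ 3 * r i
  · obtain ⟨i, hi⟩ := hnear
    refine ⟨p i, 3 * r i, by linarith [hr i], hi, ?_⟩
    rw [Real.mul_rpow (by norm_num) (hr i).le, ENNReal.ofReal_mul (by positivity)]
    gcongr
    · exact le_max_left _ _
    · refine le_trans ?_ (ENNReal.le_tsum i)
      rw [indicator_of_mem]
      exact mem_closedBall_self (by linarith [hr i])
  · push Not at hnear
    obtain ⟨ρ, hρ, hle⟩ := h x hx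
    refine ⟨x, 2 * ρ, by linarith, mem_closedBall_self (by linarith), ?_⟩
    have h1 : ENNReal.ofReal (κ * ρ ^ t) ≤
        ∑' j, {j | p j ∈ closedBall x (2 * ρ)}.indicator (fun i => ENNReal.ofReal (r i ^ t)) j := by
      calc ENNReal.ofReal (κ * ρ ^ t)
          = ENNReal.ofReal (ρ ^ (t - s)) * ENNReal.ofReal (κ * ρ ^ s) := by
            rw [← ENNReal.ofReal_mul (by positivity), mul_left_comm, ← Real.rpow_add hρ]
            simp
        _ ≤ ENNReal.ofReal (ρ ^ (t - s)) * touchingSum s p r x ρ := by gcongr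
        _ ≤ _ := by
            rw [touchingSum, ← ENNReal.tsum_mul_left]
            refine ENNReal.tsum_le_tsum fun i => ?_
            by_cases hi : dist x (p i) ≤ r i + ρ
            · have h3 := hnear i
              have hri := hr i
              rw [indicator_of_mem (show i ∈ {i | dist x (p i) ≤ r i + ρ} from hi),
                indicator_of_mem, ← ENNReal.ofReal_mul (by positivity)]
              · refine ENNReal.ofReal_le_ofReal ?_
                calc ρ ^ (t - s) * r i ^ s ≤ r i ^ (t - s) * r i ^ s :=
                      mul_le_mul_of_nonneg_right
                        (Real.rpow_le_rpow_of_nonpos hri (by linarith) (by linarith))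
                        (by positivity)
                  _ = r i ^ t := by rw [← Real.rpow_add hri]; simp
              · change dist (p i) x ≤ 2 * ρ
                rw [dist_comm]; linarith
            · rw [indicator_of_notMem (show i ∉ {i | dist x (p i) ≤ r i + ρ} from hi), mul_zero]
              exact zero_le
    calc ENNReal.ofReal ((2 * ρ) ^ t)
        = ENNReal.ofReal (2 ^ t / κ) * ENNReal.ofReal (κ * ρ ^ t) := by
          rw [← ENNReal.ofReal_mul (by positivity), Real.mul_rpow (by norm_num) hρ.le]
          congr 1; field_simp
      _ ≤ _ := by
          gcongr
          exact le_max_right _ _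

/-- The content of `F` in each ball of radius `ρ ≤ R₀`, centred anywhere in the space, is at least
`c * ρ ^ s`. -/
def LowerContentBound {X : Type*} [MetricSpace X] (s c R₀ : ℝ) (F : Set X) : Prop :=
  ∀ (x : X) (ρ : ℝ), 0 < ρ → ρ ≤ R₀ → ENNReal.ofReal (c * ρ ^ s) ≤ hausdorffContent s (F ∩ ball x ρ)

/-- A cover of `F ∩ ball x ρ` by closed balls has large touching sum at `(x, ρ)`. -/
theorem le_touchingSum {X ι : Type*} [MetricSpace X] [Countable ι] {s c ρ : ℝ} (hs : 0 < s)
    {x : X} {F : Set X} (hF : ENNReal.ofReal (c * ρ ^ s) ≤ hausdorffContent s (F ∩ ball x ρ))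
    (p : ι → X) (r : ι → ℝ) (hr : ∀ i, 0 < r i)
    (hcov : F ∩ ball x ρ ⊆ ⋃ i, closedBall (p i) (r i)) :
    ENNReal.ofReal (c / 2 ^ s * ρ ^ s) ≤ touchingSum s p r x ρ := by
  have h1 := hausdorffContent_le_tsum_closedBall hs
    (fun i : {i | dist x (p i) ≤ r i + ρ} => p i) (fun i => r i) (fun i => (hr i).le)
    (E := F ∩ ball x ρ) fun y hy => by
      obtain ⟨i, hi⟩ := mem_iUnion.1 (hcov hy)
      refine mem_iUnion.2 ⟨⟨i, ?_⟩, hi⟩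
      have := dist_triangle_left x (p i) y
      have h2 : dist y x < ρ := hy.2
      have h3 : dist y (p i) ≤ r i := hi
      change dist x (p i) ≤ r i + ρ
      linarith
  have h2 : ∀ i, ENNReal.ofReal ((2 * r i) ^ s) = ENNReal.ofReal (2 ^ s) * ENNReal.ofReal (r i ^ s) :=
    fun i => by rw [Real.mul_rpow (by norm_num) (hr i).le, ENNReal.ofReal_mul (by positivity)]
  simp only [h2] at h1
  rw [ENNReal.tsum_mul_left, tsum_subtype _ (fun i => ENNReal.ofReal (r i ^ s))] at h1
  have h3 := hF.trans h1
  rw [div_mul_eq_mul_div, ENNReal.ofReal_div_of_pos (by positivity)]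
  exact ENNReal.div_le_of_le_mul' h3

/-- From balls to open sets: a lower content bound on all small balls gives membership in all
classes of exponent at most `s`. -/
theorem LowerContentBound.mem_GClass {X : Type*} [MetricSpace X] {s t c R₀ : ℝ} (ht : 0 < t)
    (hts : t ≤ s) (hc : 0 < c) (hR₀ : 0 < R₀) {F : Set X} (hF : LowerContentBound s c R₀ F)
    (hFG : IsGδ F) : F ∈ GClass X t := by
  refine mem_GClass_of_le (K := 10 ^ t * max (3 ^ t) (2 ^ t / (c / 2 ^ s))) hFG fun U hU => ?_
  rcases isEmpty_or_nonempty X with hX | hX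
  · rw [Set.eq_empty_of_isEmpty U]
    refine (hausdorffContent_le_tsum ht (fun _ : Empty => ∅) (empty_subset _)).trans ?_
    simp
  refine ENNReal.le_of_forall_pos_le_add fun ε hε hfin => ?_
  by_contra hcon
  push Not at hcon
  set K := 10 ^ t * max (3 ^ t) (2 ^ t / (c / 2 ^ s)) with hK
  have hKpos : 0 < K := by positivity
  have hlt : hausdorffContent t (F ∩ U) < hausdorffContent t U / ENNReal.ofReal K := by
    rw [ENNReal.lt_div_iff_mul_lt (by simp [hKpos]) (by simp), mul_comm]
    exact lt_of_le_of_lt le_self_add hcon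
  obtain ⟨p, r, hr, hcov, hsum⟩ := exists_closedBall_cover ht hlt
  have := hausdorffContent_le_of_touchingSum (A := U) ht hts (κ := c / 2 ^ s) (by positivity) p r hr
    fun z hz => by
      obtain ⟨δ, hδ, hsub⟩ := Metric.isOpen_iff.1 hU z hz
      have hm : 0 < min δ R₀ := lt_min hδ hR₀
      refine ⟨min δ R₀, hm, le_touchingSum (ht.trans_le hts) (hF z _ hm (min_le_right _ _)) p r hr
        (subset_trans ?_ hcov)⟩
      exact inter_subset_inter_right _ ((ball_subset_ball (min_le_left _ _)).trans hsub)
  rw [ENNReal.lt_div_iff_mul_lt (by simp [hKpos]) (by simp), mul_comm] at hsum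
  exact absurd (this.trans_lt hsum) (lt_irrefl _)

/-! ### Ahlfors regularity and the mass distribution principle -/

/-- Ahlfors regularity of dimension `d` with constant `C` at all scales up to `R₀`. -/
structure AhlforsUpTo {X : Type*} [MetricSpace X] [MeasurableSpace X] (μ : Measure X)
    (d C R₀ : ℝ) : Prop where
  dim_pos : 0 < d
  const_pos : 0 < C
  scale_pos : 0 < R₀
  le_measure : ∀ (x : X) (r : ℝ), 0 < r → r ≤ R₀ → ENNReal.ofReal (C⁻¹ * r ^ d) ≤ μ (ball x r)
  measure_le : ∀ (x : X) (r : ℝ), 0 < r → r ≤ R₀ → μ (ball x r) ≤ ENNReal.ofReal (C * r ^ d)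

theorem IsAhlforsRegular.exists_ahlforsUpTo {X : Type*} [MetricSpace X] [MeasurableSpace X]
    [BorelSpace X] [Nontrivial X] {μ : Measure X} {d : ℝ} (h : IsAhlforsRegular μ d) :
    ∃ C R₀, AhlforsUpTo μ d C R₀ := by
  obtain ⟨hd, C, hC, h⟩ := h
  obtain ⟨x, y, hxy⟩ := exists_pair_ne X
  have hdiam : ∀ r ≤ dist x y, ENNReal.ofReal r ≤ ediam (univ : Set X) := fun r hr =>
    (ENNReal.ofReal_le_ofReal hr).trans
      ((edist_dist x y).symm.trans_le (edist_le_ediam_of_mem (mem_univ _) (mem_univ _)))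
  exact ⟨C, dist x y, hd, hC, dist_pos.2 hxy, fun z r hr hle => (h z r hr (hdiam r hle)).1,
    fun z r hr hle => (h z r hr (hdiam r hle)).2⟩

/-- Mass distribution principle: a set carrying a definite proportion of the mass of a ball of
radius `r` has content at least comparable to `r ^ s`. -/
theorem AhlforsUpTo.le_hausdorffContent {X : Type*} [MetricSpace X] [MeasurableSpace X]
    {μ : Measure X} {d C R₀ : ℝ} (h : AhlforsUpTo μ d C R₀) {s : ℝ} (hs : 0 < s) (hsd : s ≤ d)
    {A : Set X} {a r : ℝ} (ha : 0 < a) (hr : 0 < r) (hrR : 2 * r ≤ R₀)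
    (hA : ENNReal.ofReal (a * r ^ d) ≤ μ A) :
    ENNReal.ofReal (min 1 (a / (C * 2 ^ d)) * r ^ s) ≤ hausdorffContent s A := by
  have hC := h.const_pos
  rcases isEmpty_or_nonempty X with hX | hX
  · exfalso
    rw [Set.eq_empty_of_isEmpty A, measure_empty] at hA
    exact (ENNReal.ofReal_pos.2 (by positivity)).not_ge hA
  by_contra hcon
  push Not at hcon
  obtain ⟨p, ρ, hρ, hcov, hsum⟩ := exists_closedBall_cover hs hcon
  have hρr : ∀ i, ρ i ≤ r := by
    intro i
    have h1 := (ENNReal.le_tsum (f := fun i => ENNReal.ofReal (ρ i ^ s)) i).trans hsum.le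
    have h2 := (ENNReal.ofReal_le_ofReal_iff (by positivity)).1 h1
    refine (Real.rpow_le_rpow_iff (hρ i).le hr.le hs).1 (h2.trans ?_)
    exact mul_le_of_le_one_left (by positivity) (min_le_left _ _)
  have hball : ∀ i, μ (closedBall (p i) (ρ i)) ≤
      ENNReal.ofReal (C * 2 ^ d * r ^ (d - s)) * ENNReal.ofReal (ρ i ^ s) := by
    intro i
    have hi := hρ i
    calc μ (closedBall (p i) (ρ i)) ≤ μ (ball (p i) (2 * ρ i)) :=
          measure_mono (closedBall_subset_ball (by linarith))
      _ ≤ ENNReal.ofReal (C * (2 * ρ i) ^ d) :=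
          h.measure_le _ _ (by linarith) (by linarith [hρr i])
      _ ≤ ENNReal.ofReal (C * 2 ^ d * r ^ (d - s) * ρ i ^ s) := by
          refine ENNReal.ofReal_le_ofReal ?_
          have h1 : ρ i ^ d = ρ i ^ (d - s) * ρ i ^ s := by rw [← Real.rpow_add hi]; simp
          have h2 : ρ i ^ (d - s) ≤ r ^ (d - s) :=
            Real.rpow_le_rpow hi.le (hρr i) (by linarith)
          rw [Real.mul_rpow (by norm_num) hi.le, h1, mul_assoc, mul_assoc]
          gcongr
      _ = _ := by rw [ENNReal.ofReal_mul (by positivity)]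
  have hlt : μ A < ENNReal.ofReal (a * r ^ d) := by
    calc μ A ≤ ∑' i, μ (closedBall (p i) (ρ i)) :=
          (measure_mono hcov).trans (measure_iUnion_le _)
      _ ≤ ENNReal.ofReal (C * 2 ^ d * r ^ (d - s)) * ∑' i, ENNReal.ofReal (ρ i ^ s) := by
          rw [← ENNReal.tsum_mul_left]
          exact ENNReal.tsum_le_tsum hball
      _ < ENNReal.ofReal (C * 2 ^ d * r ^ (d - s)) *
            ENNReal.ofReal (min 1 (a / (C * 2 ^ d)) * r ^ s) :=
          (ENNReal.mul_lt_mul_iff_right (by simp; positivity) (by simp)).2 hsum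
      _ ≤ ENNReal.ofReal (a * r ^ d) := by
          rw [← ENNReal.ofReal_mul (by positivity)]
          refine ENNReal.ofReal_le_ofReal ?_
          have h1 : r ^ d = r ^ (d - s) * r ^ s := by rw [← Real.rpow_add hr]; simp
          calc _ ≤ C * 2 ^ d * r ^ (d - s) * (a / (C * 2 ^ d) * r ^ s) := by
                gcongr; exact min_le_right _ _
            _ = a * r ^ d := by rw [h1]; field_simp
  exact hlt.not_ge hA

theorem AhlforsUpTo.exists_lowerContentBound {X : Type*} [MetricSpace X] [MeasurableSpace X]
    {μ : Measure X} {d C R₀ : ℝ} (h : AhlforsUpTo μ d C R₀) {s : ℝ} (hs : 0 < s) (hsd : s ≤ d)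
    {F : Set X} (hF : F ∈ GClass X s) : ∃ c, 0 < c ∧ LowerContentBound s c (R₀ / 2) F := by
  have hC := h.const_pos
  obtain ⟨-, c, hc, -, hcF⟩ := hF
  refine ⟨c * min 1 (C⁻¹ / (C * 2 ^ d)), by positivity, fun x ρ hρ hle => ?_⟩
  rw [mul_assoc, ENNReal.ofReal_mul hc.le]
  refine le_trans ?_ (hcF _ isOpen_ball)
  gcongr
  exact h.le_hausdorffContent hs hsd (by positivity) hρ (by linarith)
    (h.le_measure x ρ hρ (by linarith))

/-! ### Dimension and bi-Lipschitz images -/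

theorem hausdorffContent_le_hausdorffMeasure {X : Type*} [MetricSpace X] [MeasurableSpace X]
    [BorelSpace X] {s : ℝ} (hs : 0 < s) (E : Set X) : hausdorffContent s E ≤ μH[s] E := by
  rw [Measure.hausdorffMeasure_apply]
  refine le_trans ?_ (le_iSup₂ (⊤ : ℝ≥0∞) ENNReal.zero_lt_top)
  refine le_iInf₂ fun A hA => le_iInf fun _ => (iInf₂_le A hA).trans
    (ENNReal.tsum_le_tsum fun n => ?_)
  rcases (A n).eq_empty_or_nonempty with h | h
  · simp [h, hs]
  · simp [h]

theorem LowerContentBound.le_dimH {X : Type*} [MetricSpace X] [Nonempty X] {s c R₀ : ℝ}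
    (hs : 0 < s) (hc : 0 < c) (hR₀ : 0 < R₀) {F : Set X} (hF : LowerContentBound s c R₀ F) :
    ENNReal.ofReal s ≤ dimH F := by
  borelize X
  obtain ⟨x⟩ := ‹Nonempty X›
  have h1 : 0 < hausdorffContent s F :=
    (ENNReal.ofReal_pos.2 (by positivity)).trans_le
      ((hF x R₀ hR₀ le_rfl).trans (hausdorffContent_mono inter_subset_left))
  refine le_dimH_of_hausdorffMeasure_ne_zero (d := s.toNNReal) ?_
  rw [Real.coe_toNNReal _ hs.le]
  exact (h1.trans_le (hausdorffContent_le_hausdorffMeasure hs F)).ne'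

theorem LipschitzWith.hausdorffContent_image_le {X Y : Type*} [MetricSpace X] [MetricSpace Y]
    {K : NNReal} {f : X → Y} (hf : LipschitzWith K f) {s : ℝ} (hs : 0 < s) (E : Set X) :
    hausdorffContent s (f '' E) ≤ ENNReal.ofReal ((K + 1) ^ s) * hausdorffContent s E := by
  have h0 : ENNReal.ofReal (((K : ℝ) + 1) ^ s) ≠ 0 := by simp; positivity
  simp only [hausdorffContent, ENNReal.mul_iInf_of_ne h0 ENNReal.ofReal_ne_top]
  refine le_iInf₂ fun A hA => (iInf₂_le (fun n => f '' A n) ?_).trans ?_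
  · rw [← image_iUnion]; exact image_mono hA
  · rw [← ENNReal.tsum_mul_left]
    refine ENNReal.tsum_le_tsum fun n => ?_
    rw [← ENNReal.ofReal_rpow_of_nonneg (by positivity) hs.le,
      ← ENNReal.mul_rpow_of_nonneg _ _ hs.le]
    refine ENNReal.rpow_le_rpow ((hf.ediam_image_le _).trans ?_) hs.le
    gcongr
    rw [← ENNReal.ofReal_coe_nnreal]
    exact ENNReal.ofReal_le_ofReal (by linarith)

theorem GClass_image {X Y : Type*} [MetricSpace X] [MetricSpace Y] {s : ℝ} (hs : 0 < s)
    (f : X ≃ₜ Y) {K L : NNReal} (hf : LipschitzWith K f) (hf' : LipschitzWith L f.symm)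
    {F : Set X} (hF : F ∈ GClass X s) : f '' F ∈ GClass Y s := by
  obtain ⟨M, hM, h⟩ := hausdorffContent_le_of_mem_GClass hF
  have hG : IsGδ (f '' F) := by
    rw [← f.preimage_symm]
    exact hF.1.preimage f.symm.continuous
  refine mem_GClass_of_le (K := (K + 1) ^ s * (M * (L + 1) ^ s)) hG fun U hU => ?_
  have h1 : f '' (f ⁻¹' U) = U := f.image_preimage U
  have h2 : f.symm '' (f '' F ∩ U) = F ∩ f ⁻¹' U := by
    rw [← h1, ← image_inter f.injective, h1, ← image_comp]; simp
  calc hausdorffContent s U = hausdorffContent s (f '' (f ⁻¹' U)) := by rw [h1]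
    _ ≤ ENNReal.ofReal ((K + 1) ^ s) * hausdorffContent s (f ⁻¹' U) :=
        hf.hausdorffContent_image_le hs _
    _ ≤ ENNReal.ofReal ((K + 1) ^ s) * (ENNReal.ofReal M *
          hausdorffContent s (F ∩ f ⁻¹' U)) := by
        gcongr; exact h _ (hU.preimage f.continuous)
    _ ≤ ENNReal.ofReal ((K + 1) ^ s) * (ENNReal.ofReal M *
          (ENNReal.ofReal ((L + 1) ^ s) * hausdorffContent s (f '' F ∩ U))) := by
        gcongr; rw [← h2]; exact hf'.hausdorffContent_image_le hs _
    _ = _ := by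
        rw [ENNReal.ofReal_mul (by positivity), ENNReal.ofReal_mul hM.le, mul_assoc, mul_assoc]

/-! ### Weighted covers and products -/

/-- Weighted covers are no more efficient than ordinary ones: if the weights of the balls
containing any given point of `A` add up to more than `h`, then `h` times the content of `A` is at
most a constant times the weighted sum `∑ w i * r i ^ s`.

Each `x ∈ A` is given a radius `ρ x` so small that already finitely many of the balls of radius at
least `ρ x` have weight more than `h` at `x`. A maximal set `J ⊆ A` for which the masses
`ρ j ^ s` of the points `j` with `closedBall j (ρ j)` inside a ball of radius `R` never exceed
`2 * R ^ s` plays the role of a Frostman measure: by maximality every point of `A` lies in a ball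
for which the packing bound is attained up to a factor `2`, so that the total mass of `J` controls the content
of `A`, while the packing bound for the balls of the cover controls the mass of `J`. -/
theorem mul_hausdorffContent_le_of_weighted {X ι : Type*} [MetricSpace X] {s h : ℝ} (hs : 0 < s)
    (hh : 0 < h) (p : ι → X) (r w : ι → ℝ) (hr : ∀ i, 0 < r i) (hw : ∀ i, 0 ≤ w i) {A : Set X}
    (hA : ∀ x ∈ A, ENNReal.ofReal h <
      ∑' i, {i | x ∈ closedBall (p i) (r i)}.indicator (fun i => ENNReal.ofReal (w i)) i) :
    ENNReal.ofReal h * hausdorffContent s A ≤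
      ENNReal.ofReal (10 ^ s * (2 * 2 ^ s)) * ∑' i, ENNReal.ofReal (w i * r i ^ s) := by
  classical
  have hI : ∀ x ∈ A, ∃ I : Finset ι, (∀ i ∈ I, x ∈ closedBall (p i) (r i)) ∧
      h < ∑ i ∈ I, w i := by
    intro x hx
    have h1 := hA x hx
    rw [ENNReal.tsum_eq_iSup_sum, lt_iSup_iff] at h1
    obtain ⟨T, hT⟩ := h1
    refine ⟨T.filter fun i => x ∈ closedBall (p i) (r i), fun i hi => (Finset.mem_filter.1 hi).2,
      ?_⟩
    have h2 : ∑ i ∈ T, {i | x ∈ closedBall (p i) (r i)}.indicator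
        (fun i => ENNReal.ofReal (w i)) i =
        ENNReal.ofReal (∑ i ∈ T.filter (fun i => x ∈ closedBall (p i) (r i)), w i) := by
      rw [ENNReal.ofReal_sum_of_nonneg fun i _ => hw i, Finset.sum_filter]
      exact Finset.sum_congr rfl fun i _ => by simp [Set.indicator_apply]
    rw [h2] at hT
    exact (ENNReal.ofReal_lt_ofReal_iff_of_nonneg hh.le).1 hT
  choose! I hIball hIsum using hI
  have hρ : ∀ x ∈ A, ∃ ρ, 0 < ρ ∧ ∀ i ∈ I x, ρ ≤ r i := by
    intro x hx
    have hne : (I x).Nonempty := by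
      by_contra hne
      have := hIsum x hx
      rw [Finset.not_nonempty_iff_eq_empty.1 hne] at this
      simp only [Finset.sum_empty] at this
      linarith
    obtain ⟨i, -, hi⟩ := Finset.exists_min_image (I x) r hne
    exact ⟨r i, hr i, hi⟩
  choose! ρ hρ0 hρr using hρ
  let 𝒥 : Set (Set X) := {J | J ⊆ A ∧ ∀ T : Finset X, (T : Set X) ⊆ J → ∀ z R, 0 < R →
    (∀ j ∈ T, dist j z + ρ j ≤ R) → ∑ j ∈ T, ρ j ^ s ≤ 2 * R ^ s}
  obtain ⟨J, hJ⟩ := zorn_subset 𝒥 fun c hc hchain => by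
    refine ⟨⋃₀ c, ⟨sUnion_subset fun J hJ => (hc hJ).1, fun T hT z R hR hTR => ?_⟩,
      fun J hJ => subset_sUnion_of_mem hJ⟩
    rcases T.eq_empty_or_nonempty with rfl | ⟨j, hj⟩
    · simp; positivity
    · obtain ⟨J₀, hJ₀, -⟩ := hT hj
      obtain ⟨J, hJ, hTJ⟩ := hchain.directedOn.exists_mem_subset_of_finite_of_subset_sUnion
        ⟨J₀, hJ₀⟩ T.finite_toSet hT
      exact (hc hJ).2 T hTJ z R hR hTR
  have hJA : J ⊆ A := hJ.prop.1
  have hcontent : hausdorffContent s A ≤ ENNReal.ofReal (10 ^ s * 1) *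
      ∑' j : J, ENNReal.ofReal (ρ j ^ s) := by
    refine hausdorffContent_le_tsum_of_indicator (fun j : J => (j : X)) _ hs one_pos
      fun x hx => ?_
    have hρx := hρ0 x hx
    by_cases hxJ : x ∈ J
    · refine ⟨x, ρ x, hρx, mem_closedBall_self hρx.le, ?_⟩
      rw [ENNReal.ofReal_one, one_mul]
      refine le_trans ?_ (ENNReal.le_tsum (⟨x, hxJ⟩ : J))
      rw [indicator_of_mem]
      exact mem_closedBall_self hρx.le
    · have hnot : insert x J ∉ 𝒥 := fun hmem =>
        hxJ (hJ.le_of_ge hmem (subset_insert x J) (mem_insert x J))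
      have hex : ∃ T : Finset X, (T : Set X) ⊆ insert x J ∧ ∃ z R, 0 < R ∧
          (∀ j ∈ T, dist j z + ρ j ≤ R) ∧ 2 * R ^ s < ∑ j ∈ T, ρ j ^ s := by
        by_contra hcon
        push Not at hcon
        exact hnot ⟨insert_subset hx hJA, hcon⟩
      obtain ⟨T, hTJ, z, R, hR, hTR, hlt⟩ := hex
      have hxT : x ∈ T := by
        by_contra hxT
        exact hlt.not_ge (hJ.prop.2 T (fun j hj => (hTJ hj).resolve_left
          (fun h => hxT (h ▸ hj))) z R hR hTR)
      have hxR := hTR x hxT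
      refine ⟨z, R, hR, by rw [mem_closedBall]; linarith, ?_⟩
      have hsum : R ^ s ≤ ∑ j ∈ T.erase x, ρ j ^ s := by
        have h1 := Finset.add_sum_erase T (fun j => ρ j ^ s) hxT
        have h2 : ρ x ^ s ≤ R ^ s :=
          Real.rpow_le_rpow hρx.le (by linarith [dist_nonneg (x := x) (y := z)]) hs.le
        linarith
      have hTe : ∀ j ∈ T.erase x, j ∈ J := fun j hj =>
        (hTJ (Finset.mem_of_mem_erase hj)).resolve_left (Finset.ne_of_mem_erase hj)
      rw [ENNReal.ofReal_one, one_mul]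
      calc ENNReal.ofReal (R ^ s) ≤ ∑ j ∈ T.erase x, ENNReal.ofReal (ρ j ^ s) := by
            rw [← ENNReal.ofReal_sum_of_nonneg fun j hj =>
              Real.rpow_nonneg (hρ0 j (hJA (hTe j hj))).le _]
            exact ENNReal.ofReal_le_ofReal hsum
        _ = ∑ j ∈ (T.erase x).subtype (· ∈ J), {j : J | (j : X) ∈ closedBall z R}.indicator
              (fun j : J => ENNReal.ofReal (ρ j ^ s)) j := by
            rw [← Finset.sum_subtype_of_mem _ hTe]
            refine Finset.sum_congr rfl fun j hj => ?_
            rw [indicator_of_mem]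
            have hjT := Finset.mem_of_mem_erase (Finset.mem_subtype.1 hj)
            have := hTR j hjT
            have := hρ0 j (hJA j.2)
            change dist (j : X) z ≤ R
            linarith
        _ ≤ _ := ENNReal.sum_le_tsum _
  have hmass : ENNReal.ofReal h * ∑' j : J, ENNReal.ofReal (ρ j ^ s) ≤
      ENNReal.ofReal (2 * 2 ^ s) * ∑' i, ENNReal.ofReal (w i * r i ^ s) := by
    rw [ENNReal.tsum_eq_iSup_sum, ENNReal.mul_iSup]
    refine iSup_le fun T => ?_
    rw [← ENNReal.ofReal_sum_of_nonneg fun (j : J) _ =>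
      Real.rpow_nonneg (hρ0 j (hJA j.2)).le _, ← ENNReal.ofReal_mul hh.le]
    -- the finite set of all balls used by the points of `T`
    let 𝓘 : Finset ι := T.biUnion fun j => I j
    have hreal : h * ∑ j ∈ T, ρ j ^ s ≤ ∑ i ∈ 𝓘, 2 * 2 ^ s * (w i * r i ^ s) := by
      calc h * ∑ j ∈ T, ρ j ^ s = ∑ j ∈ T, h * ρ j ^ s := Finset.mul_sum _ _ _
        _ ≤ ∑ j ∈ T, ∑ i ∈ 𝓘, if i ∈ I j then w i * ρ j ^ s else 0 := by
            refine Finset.sum_le_sum fun j hj => ?_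
            rw [← Finset.sum_filter]
            have h1 : 𝓘.filter (fun i => i ∈ I j) = I j := by
              ext i
              simp only [Finset.mem_filter, and_iff_right_iff_imp]
              exact fun hi => Finset.mem_biUnion.2 ⟨j, hj, hi⟩
            rw [h1, ← Finset.sum_mul]
            exact mul_le_mul_of_nonneg_right (hIsum j (hJA j.2)).le
              (Real.rpow_nonneg (hρ0 j (hJA j.2)).le _)
        _ = ∑ i ∈ 𝓘, ∑ j ∈ T, if i ∈ I j then w i * ρ j ^ s else 0 := Finset.sum_comm
        _ ≤ ∑ i ∈ 𝓘, 2 * 2 ^ s * (w i * r i ^ s) := by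
            refine Finset.sum_le_sum fun i _ => ?_
            rw [← Finset.sum_filter, ← Finset.mul_sum]
            have hri := hr i
            have h1 := hJ.prop.2 ((T.filter fun j : J => i ∈ I j).map (Function.Embedding.subtype _))
              (fun j hj => by
                obtain ⟨j', -, rfl⟩ := Finset.mem_map.1 hj
                exact j'.2) (p i) (2 * r i) (by linarith) (fun j hj => by
                obtain ⟨j', hj', rfl⟩ := Finset.mem_map.1 hj
                have hi := (Finset.mem_filter.1 hj').2
                have h2 := hIball j' (hJA j'.2) i hi
                have h3 := hρr j' (hJA j'.2) i hi
                rw [mem_closedBall] at h2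
                simp only [Function.Embedding.subtype_apply]
                linarith)
            rw [Finset.sum_map, Real.mul_rpow (by norm_num) hri.le] at h1
            calc _ ≤ w i * (2 * (2 ^ s * r i ^ s)) := mul_le_mul_of_nonneg_left h1 (hw i)
              _ = _ := by ring
    refine (ENNReal.ofReal_le_ofReal hreal).trans ?_
    have hnn : ∀ i, 0 ≤ w i * r i ^ s := fun i =>
      mul_nonneg (hw i) (Real.rpow_nonneg (hr i).le _)
    rw [← Finset.mul_sum, ENNReal.ofReal_mul (by positivity),
      ENNReal.ofReal_sum_of_nonneg fun i _ => hnn i]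
    gcongr
    exact ENNReal.sum_le_tsum _
  calc ENNReal.ofReal h * hausdorffContent s A
      ≤ ENNReal.ofReal h * (ENNReal.ofReal (10 ^ s * 1) *
          ∑' j : J, ENNReal.ofReal (ρ j ^ s)) := by gcongr
    _ = ENNReal.ofReal (10 ^ s) * (ENNReal.ofReal h * ∑' j : J, ENNReal.ofReal (ρ j ^ s)) := by
        rw [mul_one, mul_left_comm]
    _ ≤ ENNReal.ofReal (10 ^ s) * (ENNReal.ofReal (2 * 2 ^ s) *
          ∑' i, ENNReal.ofReal (w i * r i ^ s)) := by gcongr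
    _ = _ := by rw [← mul_assoc, ← ENNReal.ofReal_mul (by positivity)]

/-- Product inequality for contents. A cover of `A ×ˢ B` by balls, sliced over `x ∈ A`, covers `B`;
so the `t`-th powers of the radii are weights that turn the projections of the balls to `X` into a
weighted cover of `A`. -/
theorem mul_hausdorffContent_le_prod {X Y : Type*} [MetricSpace X] [MetricSpace Y] {s t h : ℝ}
    (hs : 0 < s) (ht : 0 < t) (hh : 0 < h) {A : Set X} {B : Set Y}
    (hB : ENNReal.ofReal h < hausdorffContent t B) :
    ENNReal.ofReal h * hausdorffContent s A ≤
      ENNReal.ofReal (10 ^ s * (2 * 2 ^ s) * 2 ^ t) * hausdorffContent (s + t) (A ×ˢ B) := by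
  rcases isEmpty_or_nonempty (X × Y) with hXY | hXY
  · have hA : A = ∅ ∨ B = ∅ := by
      rw [← prod_eq_empty_iff]; exact Set.eq_empty_of_isEmpty _
    rcases hA with rfl | rfl
    · have : hausdorffContent s (∅ : Set X) = 0 := le_antisymm
        ((hausdorffContent_le_tsum hs (fun _ : Empty => ∅) (empty_subset _)).trans (by simp))
        zero_le
      simp [this]
    · have : hausdorffContent t (∅ : Set Y) = 0 := le_antisymm
        ((hausdorffContent_le_tsum ht (fun _ : Empty => ∅) (empty_subset _)).trans (by simp))
        zero_le
      simp [this] at hB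
  set K : ℝ := 10 ^ s * (2 * 2 ^ s) * 2 ^ t with hK
  have hKpos : 0 < K := by positivity
  by_contra hcon
  push Not at hcon
  rw [mul_comm, ← ENNReal.lt_div_iff_mul_lt (by simp [hKpos]) (by simp)] at hcon
  obtain ⟨p, r, hr, hcov, hsum⟩ := exists_closedBall_cover (add_pos hs ht) hcon
  have key := mul_hausdorffContent_le_of_weighted (A := A) hs hh (fun i => (p i).1) r
    (fun i => (2 * r i) ^ t) hr (fun i => Real.rpow_nonneg (by linarith [hr i]) _)
    fun x hx => by
      refine hB.trans_le ?_
      rw [← tsum_subtype {i | x ∈ closedBall (p i).1 (r i)}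
        (fun i => ENNReal.ofReal ((2 * r i) ^ t))]
      refine hausdorffContent_le_tsum_closedBall ht
        (fun i : {i | x ∈ closedBall (p i).1 (r i)} => (p i).2) (fun i => r i)
        (fun i => (hr i).le) fun y hy => ?_
      obtain ⟨i, hi⟩ := mem_iUnion.1 (hcov (mk_mem_prod hx hy))
      rw [← closedBall_prod_same] at hi
      exact mem_iUnion.2 ⟨⟨i, hi.1⟩, hi.2⟩
  have h1 : ∀ i, ENNReal.ofReal ((2 * r i) ^ t * r i ^ s) =
      ENNReal.ofReal (2 ^ t) * ENNReal.ofReal (r i ^ (s + t)) := by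
    intro i
    rw [← ENNReal.ofReal_mul (by positivity), Real.mul_rpow (by norm_num) (hr i).le,
      add_comm s t, Real.rpow_add (hr i), mul_assoc]
  simp only [h1] at key
  rw [ENNReal.tsum_mul_left, ← mul_assoc, ← ENNReal.ofReal_mul (by positivity), ← hK] at key
  rw [ENNReal.lt_div_iff_mul_lt (by simp [hKpos]) (by simp), mul_comm] at hsum
  exact absurd (key.trans_lt hsum) (lt_irrefl _)

theorem LowerContentBound.prod {X Y : Type*} [MetricSpace X] [MetricSpace Y] {s t a b R₁ R₂ : ℝ}
    (hs : 0 < s) (ht : 0 < t) (hb : 0 < b) {F : Set X} {G : Set Y}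
    (hF : LowerContentBound s a R₁ F) (hG : LowerContentBound t b R₂ G) :
    LowerContentBound (s + t) (b / 2 * a / (10 ^ s * (2 * 2 ^ s) * 2 ^ t)) (min R₁ R₂)
      (F ×ˢ G) := by
  rintro ⟨x, y⟩ ρ hρ hle
  have h1 := hF x ρ hρ (hle.trans (min_le_left _ _))
  have h2 := hG y ρ hρ (hle.trans (min_le_right _ _))
  have h3 : ENNReal.ofReal (b / 2 * ρ ^ t) < hausdorffContent t (G ∩ ball y ρ) := by
    refine lt_of_lt_of_le ((ENNReal.ofReal_lt_ofReal_iff (by positivity)).2 ?_) h2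
    have : 0 < b * ρ ^ t := by positivity
    linarith
  have h4 := mul_hausdorffContent_le_prod hs ht (A := F ∩ ball x ρ) (by positivity) h3
  rw [← ball_prod_same, prod_inter_prod]
  rw [div_mul_eq_mul_div, ENNReal.ofReal_div_of_pos (by positivity)]
  refine ENNReal.div_le_of_le_mul' (le_trans ?_ h4)
  calc ENNReal.ofReal (b / 2 * a * ρ ^ (s + t))
      = ENNReal.ofReal (b / 2 * ρ ^ t) * ENNReal.ofReal (a * ρ ^ s) := by
        rw [← ENNReal.ofReal_mul (by positivity), Real.rpow_add hρ]
        ring_nf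
    _ ≤ _ := by gcongr

/-! ### Countable intersections: the critical exponent -/

theorem AhlforsUpTo.hausdorffContent_le_of_isOpen {X : Type*} [MetricSpace X] [MeasurableSpace X]
    [BorelSpace X] {μ : Measure X} {d C R₀ : ℝ} (h : AhlforsUpTo μ d C R₀) {W : Set X}
    (hW : IsOpen W) : hausdorffContent d W ≤ ENNReal.ofReal (10 ^ d * C) * μ W := by
  have hC := h.const_pos
  have key := hausdorffContent_le_measure (μ.restrict W) h.dim_pos hC (A := W) fun x hx => ?_
  · simpa using key
  · obtain ⟨δ, hδ, hsub⟩ := Metric.nhds_basis_closedBall.mem_iff.1 (hW.mem_nhds hx)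
    have hm : 0 < min δ R₀ := lt_min hδ h.scale_pos
    refine ⟨x, min δ R₀, hm, mem_closedBall_self hm.le, ?_⟩
    rw [Measure.restrict_apply measurableSet_closedBall, inter_eq_left.2
      ((closedBall_subset_closedBall (min_le_left _ _)).trans hsub)]
    calc ENNReal.ofReal (min δ R₀ ^ d)
        = ENNReal.ofReal C * ENNReal.ofReal (C⁻¹ * min δ R₀ ^ d) := by
          rw [← ENNReal.ofReal_mul hC.le]
          congr 1; field_simp
      _ ≤ ENNReal.ofReal C * μ (closedBall x (min δ R₀)) := by
          gcongr
          exact (h.le_measure x _ hm (min_le_right _ _)).trans (measure_mono ball_subset_closedBall)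

/-- An open set of the class of exponent `d` has full measure: on an open set `V` containing
the complement of `G` and nearly no more, the content of `V` is bounded by that of `G ∩ V`, which
is bounded by the measure of `G ∩ V`. -/
theorem AhlforsUpTo.measure_ball_diff_eq_zero {X : Type*} [MetricSpace X] [MeasurableSpace X]
    [BorelSpace X] {μ : Measure X} {d C R₀ : ℝ} (h : AhlforsUpTo μ d C R₀) {G : Set X}
    (hG : IsOpen G) (hGd : G ∈ GClass X d) (x : X) {r : ℝ} (hr : 0 < r) (hrR : 2 * r ≤ R₀) :
    μ (ball x r \ G) = 0 := by
  have hC := h.const_pos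
  have hBfin : μ (ball x r) < ∞ :=
    (h.measure_le x r hr (by linarith)).trans_lt ENNReal.ofReal_lt_top
  have hfin : IsFiniteMeasure (μ.restrict (ball x r)) := ⟨by simpa using hBfin⟩
  obtain ⟨M, hM, hMG⟩ := hausdorffContent_le_of_mem_GClass hGd
  by_contra hne
  have hnt : μ (ball x r \ G) ≠ ∞ := ((measure_mono sdiff_subset).trans_lt hBfin).ne
  set a := (μ (ball x r \ G)).toReal / r ^ d with ha_def
  have ha : 0 < a := div_pos (ENNReal.toReal_pos hne hnt) (by positivity)
  have har : ENNReal.ofReal (a * r ^ d) = μ (ball x r \ G) := by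
    rw [ha_def, div_mul_cancel₀ _ (by positivity), ENNReal.ofReal_toReal hnt]
  set b := min 1 (a / (C * 2 ^ d)) * r ^ d with hb_def
  have hb : 0 < b := by positivity
  set K := M * (10 ^ d * C) with hK_def
  have hK : 0 < K := by positivity
  obtain ⟨A, hAsub, hA, hAlt⟩ := (hG.inter (isOpen_ball (x := x) (ε := r))).measurableSet
    |>.exists_isClosed_sdiff_lt (μ := μ.restrict (ball x r)) (measure_ne_top _ _)
    (ε := ENNReal.ofReal (b / K)) (by simp; positivity)
  have hV : G ∩ (ball x r \ A) = (G ∩ ball x r) \ A := by rw [inter_sdiff_assoc]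
  rw [Measure.restrict_apply ((hG.inter isOpen_ball).measurableSet.diff hA.measurableSet),
    inter_eq_left.2 (sdiff_subset.trans inter_subset_right), ← hV] at hAlt
  have hVo : IsOpen (ball x r \ A) := isOpen_ball.sdiff hA
  have hlow : ENNReal.ofReal b ≤ hausdorffContent d (ball x r \ A) := by
    refine h.le_hausdorffContent h.dim_pos le_rfl ha hr hrR ?_
    rw [har]
    exact measure_mono (sdiff_subset_sdiff_right (hAsub.trans inter_subset_left))
  have hup : hausdorffContent d (ball x r \ A) < ENNReal.ofReal b := by
    calc hausdorffContent d (ball x r \ A)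
        ≤ ENNReal.ofReal M * hausdorffContent d (G ∩ (ball x r \ A)) := hMG _ hVo
      _ ≤ ENNReal.ofReal M * (ENNReal.ofReal (10 ^ d * C) * μ (G ∩ (ball x r \ A))) := by
          gcongr; exact h.hausdorffContent_le_of_isOpen (hG.inter hVo)
      _ = ENNReal.ofReal K * μ (G ∩ (ball x r \ A)) := by
          rw [← mul_assoc, ← ENNReal.ofReal_mul hM.le]
      _ < ENNReal.ofReal K * ENNReal.ofReal (b / K) :=
          (ENNReal.mul_lt_mul_iff_right (by simp; positivity) (by simp)).2 hAlt
      _ = ENNReal.ofReal b := by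
          rw [← ENNReal.ofReal_mul hK.le]
          congr 1; field_simp
  exact hlow.not_gt hup

theorem AhlforsUpTo.lowerContentBound_iInter_of_eq {X : Type*} [MetricSpace X] [MeasurableSpace X]
    [BorelSpace X] {μ : Measure X} {d C R₀ : ℝ} (h : AhlforsUpTo μ d C R₀) {G : ℕ → Set X}
    (hG : ∀ k, IsOpen (G k)) (hGd : ∀ k, G k ∈ GClass X d) :
    LowerContentBound d (min 1 (C⁻¹ / (C * 2 ^ d))) (R₀ / 2) (⋂ k, G k) := by
  intro x ρ hρ hle
  have hC := h.const_pos
  refine h.le_hausdorffContent h.dim_pos le_rfl (by positivity) hρ (by linarith) ?_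
  refine (h.le_measure x ρ hρ (by linarith)).trans ?_
  have h0 : μ (ball x ρ \ ⋂ k, G k) = 0 := by
    rw [sdiff_iInter, measure_iUnion_null_iff]
    exact fun k => h.measure_ball_diff_eq_zero (hG k) (hGd k) x hρ (by linarith)
  rw [inter_comm]
  calc μ (ball x ρ) ≤ μ (ball x ρ ∩ ⋂ k, G k) + μ (ball x ρ \ ⋂ k, G k) :=
        measure_le_inter_add_sdiff _ _ _
    _ = _ := by rw [h0, add_zero]

/-! ### Countable intersections: subcritical exponents -/

/-- If the balls `closedBall (p i) (r i)` touching `closedBall x R` have total mass at most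
`ε * R ^ s` for a small `ε`, then, as `s < d`, there are much smaller balls around
points near `x` where the normalized mass `touchingSum s p r y δ / δ ^ s` is as small as desired.
Indeed the balls larger than `δ` miss most points of `ball x (R / 2)`, and the mass of
the others is spread over about `(R / δ) ^ d` balls of radius `δ`, more than `(R / δ) ^ s`. -/
theorem AhlforsUpTo.exists_touchingSum_le {X : Type*} [MetricSpace X] [MeasurableSpace X]
    [BorelSpace X] {μ : Measure X} {d C R₀ : ℝ} (h : AhlforsUpTo μ d C R₀) {s ε : ℝ} (hs : 0 < s)
    (hsd : s < d) (hε : 0 < ε) (hε3 : ε ≤ (1 / 3) ^ s)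
    (hεC : 2 * (C * 3 ^ d * ε) < C⁻¹ * (1 / 2) ^ d) {ι : Type*} [Countable ι] (p : ι → X)
    (r : ι → ℝ) (hr : ∀ i, 0 < r i) {x : X} {R : ℝ} (hR : 0 < R) (hRR : R ≤ R₀)
    (hx : touchingSum s p r x R ≤ ENNReal.ofReal (ε * R ^ s)) {θ : ℝ} (hθ : 0 < θ) :
    ∃ y δ, 0 < δ ∧ δ ≤ R / 3 ∧ dist y x < R / 2 ∧
      touchingSum s p r y δ ≤ ENNReal.ofReal (θ * δ ^ s) := by
  have hC := h.const_pos
  have hds : 0 < d - s := by linarith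
  set N : Set ι := {i | dist x (p i) ≤ r i + R} with hN
  set a : ι → ℝ≥0∞ := N.indicator fun i => ENNReal.ofReal (r i ^ s) with ha
  have hasum : ∑' i, a i ≤ ENNReal.ofReal (ε * R ^ s) := hx
  set δ := min (R / 3) (R * θ ^ (d - s)⁻¹) with hδdef
  have hδ : 0 < δ := by positivity
  have hδR : δ ≤ R / 3 := min_le_left _ _
  -- the choice of `δ` makes the bound from Markov's inequality independent of `θ`
  have hδθ : δ ^ (d - s) ≤ θ * R ^ (d - s) := by
    calc δ ^ (d - s) ≤ (R * θ ^ (d - s)⁻¹) ^ (d - s) :=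
          Real.rpow_le_rpow hδ.le (min_le_right _ _) hds.le
      _ = θ * R ^ (d - s) := by
          rw [Real.mul_rpow hR.le (by positivity), Real.rpow_inv_rpow hθ.le hds.ne', mul_comm]
  have hrR : ∀ i ∈ N, r i ≤ R / 3 := by
    intro i hi
    have h1 : a i ≤ ENNReal.ofReal (ε * R ^ s) := (ENNReal.le_tsum i).trans hasum
    rw [ha, indicator_of_mem hi] at h1
    have h2 := (ENNReal.ofReal_le_ofReal_iff (by positivity)).1 h1
    refine (Real.rpow_le_rpow_iff (hr i).le (by positivity) hs).1 (h2.trans ?_)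
    rw [div_eq_inv_mul, ← one_div, Real.mul_rpow (by norm_num) hR.le]
    gcongr
  set bad : Set X := ⋃ i, ⋃ (_ : i ∈ N ∧ δ < r i), ball (p i) (3 * r i) with hbad
  have hbadμ : μ bad ≤ ENNReal.ofReal (C * 3 ^ d * ε * R ^ d) := by
    calc μ bad ≤ ∑' i, μ (⋃ (_ : i ∈ N ∧ δ < r i), ball (p i) (3 * r i)) := measure_iUnion_le _
      _ ≤ ∑' i, ENNReal.ofReal (C * 3 ^ d * R ^ (d - s)) * a i := by
          refine ENNReal.tsum_le_tsum fun i => ?_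
          by_cases hi : i ∈ N ∧ δ < r i
          · have hri := hr i
            have hriR := hrR i hi.1
            simp only [hi, and_self, iUnion_true, ha, indicator_of_mem hi.1]
            refine (h.measure_le _ _ (by linarith) (by linarith)).trans ?_
            rw [← ENNReal.ofReal_mul (by positivity)]
            refine ENNReal.ofReal_le_ofReal ?_
            have h1 : r i ^ d = r i ^ (d - s) * r i ^ s := by rw [← Real.rpow_add hri]; simp
            have h2 : r i ^ (d - s) ≤ R ^ (d - s) :=
              Real.rpow_le_rpow hri.le (by linarith) hds.le
            rw [Real.mul_rpow (by norm_num) hri.le, h1, mul_assoc, mul_assoc]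
            gcongr
          · simp [hi]
      _ = ENNReal.ofReal (C * 3 ^ d * R ^ (d - s)) * ∑' i, a i := ENNReal.tsum_mul_left
      _ ≤ ENNReal.ofReal (C * 3 ^ d * R ^ (d - s)) * ENNReal.ofReal (ε * R ^ s) := by gcongr
      _ = _ := by
          rw [← ENNReal.ofReal_mul (by positivity)]
          have h1 : R ^ d = R ^ (d - s) * R ^ s := by rw [← Real.rpow_add hR]; simp
          rw [h1]; ring_nf
  set g : X → ℝ≥0∞ := fun y => ∑' i, (ball (p i) (3 * δ)).indicator (fun _ => a i) y with hg
  have hgm : Measurable g :=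
    Measurable.tsum fun i => measurable_const.indicator measurableSet_ball
  have hgint : ∫⁻ y, g y ∂μ ≤ ENNReal.ofReal (C * (3 * δ) ^ d * (ε * R ^ s)) := by
    rw [hg, lintegral_tsum fun i => (measurable_const.indicator measurableSet_ball).aemeasurable]
    calc ∑' i, ∫⁻ y, (ball (p i) (3 * δ)).indicator (fun _ => a i) y ∂μ
        ≤ ∑' i, a i * ENNReal.ofReal (C * (3 * δ) ^ d) := by
          refine ENNReal.tsum_le_tsum fun i => ?_
          rw [lintegral_indicator_const measurableSet_ball]
          gcongr
          exact h.measure_le _ _ (by linarith) (by linarith)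
      _ = (∑' i, a i) * ENNReal.ofReal (C * (3 * δ) ^ d) := ENNReal.tsum_mul_right
      _ ≤ ENNReal.ofReal (ε * R ^ s) * ENNReal.ofReal (C * (3 * δ) ^ d) := by gcongr
      _ = _ := by rw [mul_comm, ← ENNReal.ofReal_mul (by positivity)]
  have hmarkov : μ {y | ENNReal.ofReal (θ * δ ^ s) ≤ g y} ≤
      ENNReal.ofReal (C * 3 ^ d * ε * R ^ d) := by
    refine (meas_ge_le_lintegral_div hgm.aemeasurable (by simp; positivity) (by simp)).trans ?_
    refine ENNReal.div_le_of_le_mul (hgint.trans ?_)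
    rw [← ENNReal.ofReal_mul (by positivity)]
    refine ENNReal.ofReal_le_ofReal ?_
    have h1 : R ^ d = R ^ (d - s) * R ^ s := by rw [← Real.rpow_add hR]; simp
    have h2 : δ ^ d = δ ^ (d - s) * δ ^ s := by rw [← Real.rpow_add hδ]; simp
    calc C * (3 * δ) ^ d * (ε * R ^ s)
        = C * 3 ^ d * ε * R ^ s * δ ^ s * δ ^ (d - s) := by
          rw [Real.mul_rpow (by norm_num) hδ.le, h2]; ring
      _ ≤ C * 3 ^ d * ε * R ^ s * δ ^ s * (θ * R ^ (d - s)) := by gcongr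
      _ = _ := by rw [h1]; ring
  by_contra hcon
  push Not at hcon
  have hsub : ball x (R / 2) ⊆ bad ∪ {y | ENNReal.ofReal (θ * δ ^ s) ≤ g y} := by
    intro y hy
    by_cases hyb : y ∈ bad
    · exact Or.inl hyb
    refine Or.inr ((hcon y δ hδ hδR hy).le.trans (ENNReal.tsum_le_tsum fun i => ?_))
    by_cases hi : dist y (p i) ≤ r i + δ
    · have hiN : i ∈ N := by
        have := dist_triangle_left x (p i) y
        rw [mem_ball] at hy
        change dist x (p i) ≤ r i + R
        linarith
      have hsmall : r i ≤ δ := by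
        by_contra hlt
        push Not at hlt
        refine hyb (mem_iUnion₂.2 ⟨i, ⟨hiN, hlt⟩, ?_⟩)
        rw [mem_ball]; linarith [hr i]
      rw [indicator_of_mem (show i ∈ {i | dist y (p i) ≤ r i + δ} from hi),
        indicator_of_mem (by rw [mem_ball]; linarith), ha, indicator_of_mem hiN]
    · rw [indicator_of_notMem (show i ∉ {i | dist y (p i) ≤ r i + δ} from hi)]
      exact zero_le
  have hlt : μ (ball x (R / 2)) < ENNReal.ofReal (C⁻¹ * (R / 2) ^ d) := by
    calc μ (ball x (R / 2)) ≤ μ bad + μ {y | ENNReal.ofReal (θ * δ ^ s) ≤ g y} :=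
          (measure_mono hsub).trans (measure_union_le _ _)
      _ ≤ ENNReal.ofReal (C * 3 ^ d * ε * R ^ d) + ENNReal.ofReal (C * 3 ^ d * ε * R ^ d) :=
          add_le_add hbadμ hmarkov
      _ = ENNReal.ofReal (2 * (C * 3 ^ d * ε) * R ^ d) := by
          rw [← ENNReal.ofReal_add (by positivity) (by positivity)]
          ring_nf
      _ < ENNReal.ofReal (C⁻¹ * (R / 2) ^ d) := by
          refine (ENNReal.ofReal_lt_ofReal_iff (by positivity)).2 ?_
          have h1 : (R / 2) ^ d = (1 / 2) ^ d * R ^ d := by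
            rw [← Real.mul_rpow (by norm_num) hR.le, one_div_mul_eq_div]
          have h2 := mul_lt_mul_of_pos_right hεC (show 0 < R ^ d by positivity)
          rw [h1]
          linarith
  exact hlt.not_ge (h.le_measure x (R / 2) (by linarith) (by linarith))

/-- If the normalized mass touching `closedBall y δ` is very small, then some ball contained in
the open set `G` and in `ball y δ` has normalized mass at most `ε`; otherwise the covering
theorem `hausdorffContent_le_of_touchingSum` would make the content of `G ∩ ball y (δ / 2)`
too small. -/
theorem LowerContentBound.exists_closedBall_subset {X : Type*} [MetricSpace X] {s c R₀ : ℝ}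
    (hs : 0 < s) {G : Set X} (hG : IsOpen G) (hGc : LowerContentBound s c R₀ G) {ε θ : ℝ}
    (hε : 0 < ε) (hθ : 10 ^ s * max (3 ^ s) (2 ^ s / ε) * θ < c * (1 / 2) ^ s) {ι : Type*}
    (p : ι → X) (r : ι → ℝ) (hr : ∀ i, 0 < r i) {y : X} {δ η : ℝ} (hδ : 0 < δ) (hδR : δ / 2 ≤ R₀)
    (hη : 0 < η) (hy : touchingSum s p r y δ ≤ ENNReal.ofReal (θ * δ ^ s)) (hc : 0 < c) :
    ∃ z ρ, 0 < ρ ∧ ρ ≤ η ∧ closedBall z ρ ⊆ G ∩ ball y δ ∧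
      touchingSum s p r z ρ ≤ ENNReal.ofReal (ε * ρ ^ s) := by
  by_contra hcon
  push Not at hcon
  set N : Set ι := {i | dist y (p i) ≤ r i + δ} with hN
  have key := hausdorffContent_le_of_touchingSum (A := G ∩ ball y (δ / 2)) hs le_rfl hε
    (fun i : N => p i) (fun i => r i) (fun i => hr i) fun z hz => by
      obtain ⟨ρ₀, hρ₀, hsub⟩ := Metric.nhds_basis_closedBall.mem_iff.1
        ((hG.inter isOpen_ball).mem_nhds hz)
      set ρ := min ρ₀ (min η (δ / 2)) with hρdef
      have hρ : 0 < ρ := by positivity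
      have hρη : ρ ≤ η := (min_le_right _ _).trans (min_le_left _ _)
      have hρδ : ρ ≤ δ / 2 := (min_le_right _ _).trans (min_le_right _ _)
      refine ⟨ρ, hρ, (hcon z ρ hρ hρη ?_).le.trans ?_⟩
      · refine ((closedBall_subset_closedBall (min_le_left _ _)).trans hsub).trans ?_
        exact inter_subset_inter_right _ (ball_subset_ball (by linarith))
      · rw [touchingSum, touchingSum]
        change _ ≤ ∑' i : N, {i | dist z (p i) ≤ r i + ρ}.indicator
          (fun i => ENNReal.ofReal (r i ^ s)) (i : ι)
        rw [tsum_subtype N ({i | dist z (p i) ≤ r i + ρ}.indicator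
          (fun i => ENNReal.ofReal (r i ^ s))), indicator_indicator, inter_eq_right.2]
        intro i hi
        have h1 : dist z (p i) ≤ r i + ρ := hi
        have h2 : dist z y < δ / 2 := hz.2
        have := dist_triangle_left y (p i) z
        change dist y (p i) ≤ r i + δ
        linarith
  rw [tsum_subtype N (fun i => ENNReal.ofReal (r i ^ s))] at key
  have hlow := hGc y (δ / 2) (by linarith) hδR
  have hup : hausdorffContent s (G ∩ ball y (δ / 2)) < ENNReal.ofReal (c * (δ / 2) ^ s) := by
    calc _ ≤ ENNReal.ofReal (10 ^ s * max (3 ^ s) (2 ^ s / ε)) * ENNReal.ofReal (θ * δ ^ s) :=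
          key.trans (mul_le_mul_right hy _)
      _ = ENNReal.ofReal (10 ^ s * max (3 ^ s) (2 ^ s / ε) * θ * δ ^ s) := by
          rw [← ENNReal.ofReal_mul (by positivity), ← mul_assoc]
      _ < _ := by
          refine (ENNReal.ofReal_lt_ofReal_iff (by positivity)).2 ?_
          have h1 : (δ / 2) ^ s = (1 / 2) ^ s * δ ^ s := by
            rw [← Real.mul_rpow (by norm_num) hδ.le, one_div_mul_eq_div]
          rw [h1, ← mul_assoc]
          exact mul_lt_mul_of_pos_right hθ (by positivity)
  exact hlow.not_gt hup

/-- In a complete space, a sequence of nested closed balls whose radii tend to `0` has a common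
point. -/
theorem exists_mem_closedBall_of_nested {X : Type*} [MetricSpace X] [CompleteSpace X] (z : ℕ → X)
    (ρ : ℕ → ℝ) (hρ : ∀ k, 0 ≤ ρ k) (hlim : Filter.Tendsto ρ Filter.atTop (nhds 0))
    (hnest : ∀ k, closedBall (z (k + 1)) (ρ (k + 1)) ⊆ closedBall (z k) (ρ k)) :
    ∃ x, ∀ k, x ∈ closedBall (z k) (ρ k) := by
  have hanti : Antitone fun k => closedBall (z k) (ρ k) := antitone_nat_of_succ_le hnest
  have hmem : ∀ n m, n ≤ m → z m ∈ closedBall (z n) (ρ n) := fun n m hnm =>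
    hanti hnm (mem_closedBall_self (hρ m))
  have hc : CauchySeq z := by
    refine cauchySeq_of_le_tendsto_0 (fun k => ρ k + ρ k) (fun n m k hn hm => ?_)
      (by simpa using hlim.add hlim)
    exact (dist_triangle_right _ _ (z k)).trans (add_le_add (hmem k n hn) (hmem k m hm))
  obtain ⟨x, hx⟩ := cauchySeq_tendsto_of_complete hc
  exact ⟨x, fun k => isClosed_closedBall.mem_of_tendsto hx
    (Filter.eventually_atTop.2 ⟨k, fun m hm => hmem k m hm⟩)⟩

/-- A Baire category argument. Given a cover of `(⋂ k, G k) ∩ ball x ρ` of small mass, one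
constructs nested balls inside `G 0, G 1, …` along which the normalized mass touching the ball stays
at most `ε`; their common point cannot lie in any set of the cover, since that set
touches all the balls. The constant `ε` is independent of the open sets `G k`, although their
lower content bounds are not assumed uniform. -/
theorem AhlforsUpTo.lowerContentBound_iInter_of_lt {X : Type*} [MetricSpace X] [MeasurableSpace X]
    [BorelSpace X] [CompleteSpace X] {μ : Measure X} {d C R₀ : ℝ} (h : AhlforsUpTo μ d C R₀)
    {s ε : ℝ} (hs : 0 < s) (hsd : s < d) (hε : 0 < ε) (hε3 : ε ≤ (1 / 3) ^ s)
    (hεC : 2 * (C * 3 ^ d * ε) < C⁻¹ * (1 / 2) ^ d) {G : ℕ → Set X} (hG : ∀ k, IsOpen (G k))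
    (hGs : ∀ k, G k ∈ GClass X s) : LowerContentBound s ε R₀ (⋂ k, G k) := by
  intro x₀ ρ₀ hρ₀ hle
  have hne : Nonempty X := ⟨x₀⟩
  have hR₀ := h.scale_pos
  by_contra hcon
  push Not at hcon
  obtain ⟨p, r, hr, hcov, hsum⟩ := exists_closedBall_cover hs hcon
  let P : X × ℝ → Prop := fun q => 0 < q.2 ∧ q.2 ≤ R₀ ∧
    touchingSum s p r q.1 q.2 ≤ ENNReal.ofReal (ε * q.2 ^ s)
  have hstep : ∀ (k : ℕ) (q : {q // P q}), ∃ q' : {q // P q}, q'.1.2 ≤ 1 / ((k : ℝ) + 1) ∧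
      closedBall q'.1.1 q'.1.2 ⊆ G k ∩ ball q.1.1 q.1.2 := by
    rintro k ⟨⟨x, R⟩, hR, hRR, hx⟩
    simp only at hR hRR hx
    obtain ⟨c, hc, hGc⟩ := h.exists_lowerContentBound hs hsd.le (hGs k)
    set Q := 10 ^ s * max (3 ^ s) (2 ^ s / ε) with hQ
    have hQpos : 0 < Q := by positivity
    obtain ⟨y, δ, hδ, hδR, hyx, hy⟩ := h.exists_touchingSum_le hs hsd hε hε3 hεC p r hr hR hRR hx
      (θ := c * (1 / 2) ^ s / (2 * Q)) (by positivity)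
    obtain ⟨z, ρ, hρ, hρη, hsub, hz⟩ := hGc.exists_closedBall_subset hs (hG k) hε
      (by
        rw [← hQ]
        have : 0 < c * (1 / 2) ^ s := by positivity
        calc Q * (c * (1 / 2) ^ s / (2 * Q)) = c * (1 / 2) ^ s / 2 := by field_simp
          _ < _ := by linarith) p r hr (η := min R₀ (1 / ((k : ℝ) + 1))) hδ (by linarith)
      (by positivity) hy hc
    refine ⟨⟨(z, ρ), hρ, hρη.trans (min_le_left _ _), hz⟩, hρη.trans (min_le_right _ _),
      hsub.trans (inter_subset_inter_right _ (ball_subset_ball' ?_))⟩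
    change δ + dist y x ≤ R
    linarith
  choose next hnext_le hnext_sub using hstep
  have h0 : P (x₀, ρ₀) := by
    refine ⟨hρ₀, hle, le_trans (ENNReal.tsum_le_tsum fun i => ?_) hsum.le⟩
    exact indicator_le_self _ _ i
  let q : ℕ → {q // P q} := fun k => Nat.rec ⟨(x₀, ρ₀), h0⟩ next k
  have hq : ∀ k, q (k + 1) = next k (q k) := fun k => rfl
  have hlim : Filter.Tendsto (fun k => (q k).1.2) Filter.atTop (nhds 0) := by
    rw [← Filter.tendsto_add_atTop_iff_nat 1]
    refine squeeze_zero (fun k => (q (k + 1)).2.1.le) (fun k => ?_)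
      tendsto_one_div_add_atTop_nhds_zero_nat
    rw [hq]; exact hnext_le k _
  have hsub : ∀ k, closedBall (q (k + 1)).1.1 (q (k + 1)).1.2 ⊆
      G k ∩ ball (q k).1.1 (q k).1.2 := fun k => by rw [hq]; exact hnext_sub k _
  obtain ⟨x, hx⟩ := exists_mem_closedBall_of_nested (fun k => (q k).1.1) (fun k => (q k).1.2)
    (fun k => (q k).2.1.le) hlim
    fun k => (hsub k).trans (inter_subset_right.trans ball_subset_closedBall)
  have hxE : x ∈ (⋂ k, G k) ∩ ball x₀ ρ₀ :=
    ⟨mem_iInter.2 fun k => (hsub k (hx (k + 1))).1, (hsub 0 (hx 1)).2⟩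
  obtain ⟨i, hi⟩ := mem_iUnion.1 (hcov hxE)
  have hri := hr i
  have hbound : ∀ k, r i ^ s ≤ ε * (q k).1.2 ^ s := by
    intro k
    have hqk := (q k).2.1
    have hmem : i ∈ {i | dist (q k).1.1 (p i) ≤ r i + (q k).1.2} := by
      have := dist_triangle_left (q k).1.1 (p i) x
      have h1 : dist x (q k).1.1 ≤ (q k).1.2 := hx k
      have h2 : dist x (p i) ≤ r i := hi
      change dist (q k).1.1 (p i) ≤ r i + (q k).1.2
      linarith
    have h1 := (ENNReal.le_tsum (f := {i | dist (q k).1.1 (p i) ≤ r i + (q k).1.2}.indicator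
      (fun i => ENNReal.ofReal (r i ^ s))) i).trans (q k).2.2.2
    rw [indicator_of_mem hmem] at h1
    exact (ENNReal.ofReal_le_ofReal_iff (by positivity)).1 h1
  have hlim' : Filter.Tendsto (fun k => ε * (q k).1.2 ^ s) Filter.atTop (nhds 0) := by
    have := (hlim.rpow_const (p := s) (Or.inr hs.le)).const_mul ε
    simpa [Real.zero_rpow hs.ne'] using this
  have : r i ^ s ≤ 0 := ge_of_tendsto' hlim' hbound
  exact absurd this (not_le.2 (by positivity))

theorem AhlforsUpTo.exists_lowerContentBound_iInter {X : Type*} [MetricSpace X]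
    [MeasurableSpace X] [BorelSpace X] [CompleteSpace X] {μ : Measure X} {d C R₀ : ℝ}
    (h : AhlforsUpTo μ d C R₀) {s : ℝ} (hs : 0 < s) (hsd : s ≤ d) {G : ℕ → Set X}
    (hG : ∀ k, IsOpen (G k)) (hGs : ∀ k, G k ∈ GClass X s) :
    ∃ c R, 0 < c ∧ 0 < R ∧ LowerContentBound s c R (⋂ k, G k) := by
  have hC := h.const_pos
  have hR := h.scale_pos
  rcases hsd.eq_or_lt with rfl | hlt
  · exact ⟨_, R₀ / 2, by positivity, by positivity, h.lowerContentBound_iInter_of_eq hG hGs⟩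
  · refine ⟨min ((1 / 3) ^ s) (C⁻¹ * (1 / 2) ^ d / (4 * (C * 3 ^ d))), R₀, by positivity, hR,
      h.lowerContentBound_iInter_of_lt hs hlt (by positivity) (min_le_left _ _) ?_ hG hGs⟩
    have h1 : 0 < C⁻¹ * (1 / 2) ^ d := by positivity
    calc _ ≤ 2 * (C * 3 ^ d * (C⁻¹ * (1 / 2) ^ d / (4 * (C * 3 ^ d)))) := by
          gcongr; exact min_le_right _ _
      _ = C⁻¹ * (1 / 2) ^ d / 2 := by
          generalize C⁻¹ * (1 / 2) ^ d = w
          field_simp; ring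
      _ < _ := by linarith

/-- Every nonempty countable family of `G_δ` sets has the same intersection as some sequence of open sets
each containing a member of the family. -/
theorem exists_isOpen_seq_sInter_eq {X : Type*} [TopologicalSpace X] {𝓕 : Set (Set X)}
    (h𝓕 : 𝓕.Countable) (hne : 𝓕.Nonempty) (hG : ∀ F ∈ 𝓕, IsGδ F) :
    ∃ G : ℕ → Set X, (∀ k, IsOpen (G k)) ∧ (∀ k, ∃ F ∈ 𝓕, F ⊆ G k) ∧ ⋂₀ 𝓕 = ⋂ k, G k := by
  obtain ⟨F, rfl⟩ := h𝓕.exists_eq_range hne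
  have h1 : ∀ n, ∃ f : ℕ → Set X, (∀ k, IsOpen (f k)) ∧ F n = ⋂ k, f k := fun n =>
    isGδ_iff_eq_iInter_nat.1 (hG _ (mem_range_self n))
  choose f hfo hfF using h1
  refine ⟨fun k => f k.unpair.1 k.unpair.2, fun k => hfo _ _, fun k =>
    ⟨F k.unpair.1, mem_range_self _, ?_⟩, ?_⟩
  · rw [hfF]; exact iInter_subset _ _
  · ext x
    simp only [sInter_range, mem_iInter, hfF]
    exact ⟨fun h k => h _ _, fun h n m => by simpa using h (Nat.pair n m)⟩

theorem univ_mem_GClass {X : Type*} [MetricSpace X] (s : ℝ) : (univ : Set X) ∈ GClass X s :=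
  ⟨IsGδ.univ, 1, one_pos, le_rfl, fun U _ => by simp⟩

/-! ### The permanence properties of the classes -/

theorem theorem2 {X : Type*} [MetricSpace X] [MeasurableSpace X] [BorelSpace X] [Nontrivial X]
    (μ : Measure X) (d : ℝ) (hX : IsAhlforsRegular μ d) (s : ℝ) (hs : 0 < s) (hsd : s ≤ d) :
    (∀ F ∈ GClass X s, ENNReal.ofReal s ≤ dimH F) ∧
    (∀ F ∈ GClass X s, ∀ E : Set X, F ⊆ E → IsGδ E → E ∈ GClass X s) ∧
    (∀ t : ℝ, 0 < t → t ≤ s → GClass X s ⊆ GClass X t) ∧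
    (CompleteSpace X → ∀ 𝓕 : Set (Set X), 𝓕.Countable → 𝓕 ⊆ GClass X s →
      ⋂₀ 𝓕 ∈ GClass X s) ∧
    (∀ (Y : Type*) [MetricSpace Y] [MeasurableSpace Y] [BorelSpace Y] [Nontrivial Y]
      (ν : Measure Y) (e : ℝ), IsAhlforsRegular ν e →
      ∀ f : X ≃ₜ Y, (∃ K, LipschitzWith K f) → (∃ K, AntilipschitzWith K f) →
        ∀ F : Set X, F ∈ GClass X s ↔ f '' F ∈ GClass Y s) ∧
    (∀ (Y : Type*) [MetricSpace Y] [MeasurableSpace Y] [BorelSpace Y] [Nontrivial Y]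
      (ν : Measure Y) (e : ℝ), IsAhlforsRegular ν e →
      ∀ t : ℝ, 0 < t → t ≤ e →
        ∀ F ∈ GClass X s, ∀ G ∈ GClass Y t, F ×ˢ G ∈ GClass (X × Y) (s + t)) := by
  obtain ⟨C, R₀, hA⟩ := hX.exists_ahlforsUpTo
  have hR₀ : 0 < R₀ / 2 := half_pos hA.scale_pos
  refine ⟨fun F hF => ?_, fun F hF E hFE hE => GClass_superset hF hFE hE, fun t ht hts F hF => ?_,
    fun hcomplete 𝓕 h𝓕 hsub => ?_, ?_, ?_⟩
  · obtain ⟨c, hc, hb⟩ := hA.exists_lowerContentBound hs hsd hF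
    exact hb.le_dimH hs hc hR₀
  · obtain ⟨c, hc, hb⟩ := hA.exists_lowerContentBound hs hsd hF
    exact hb.mem_GClass ht hts hc hR₀ hF.1
  · rcases 𝓕.eq_empty_or_nonempty with rfl | hne
    · rw [sInter_empty]
      exact univ_mem_GClass s
    · obtain ⟨G, hGo, hGF, hG⟩ := exists_isOpen_seq_sInter_eq h𝓕 hne fun F hF => (hsub hF).1
      obtain ⟨c, R, hc, hR, hb⟩ := hA.exists_lowerContentBound_iInter hs hsd hGo fun k => by
        obtain ⟨F, hF, hFG⟩ := hGF k
        exact GClass_superset (hsub hF) hFG (hGo k).isGδ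
      rw [hG]
      exact hb.mem_GClass hs le_rfl hc hR (IsGδ.iInter fun k => (hGo k).isGδ)
  · rintro Y _ _ _ _ ν e - f ⟨K, hK⟩ ⟨L, hL⟩ F
    have hK' : LipschitzWith K f.symm.symm := hK
    have hL' : LipschitzWith L f.symm := hL.to_rightInverse f.apply_symm_apply
    refine ⟨GClass_image hs f hK hL', fun h => ?_⟩
    have := GClass_image hs f.symm hL' hK' h
    rwa [← image_comp, f.symm_comp_self, image_id] at this
  · intro Y _ _ _ _ ν e hY t ht hte F hF G hG
    obtain ⟨D, R₁, hB⟩ := hY.exists_ahlforsUpTo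
    have hR₁ : 0 < R₁ / 2 := half_pos hB.scale_pos
    obtain ⟨a, ha, hFa⟩ := hA.exists_lowerContentBound hs hsd hF
    obtain ⟨b, hb, hGb⟩ := hB.exists_lowerContentBound ht hte hG
    refine (hFa.prod hs ht hb hGb).mem_GClass (add_pos hs ht) le_rfl (by positivity)
      (lt_min hR₀ hR₁) ?_
    exact (hF.1.preimage continuous_fst).inter (hG.1.preimage continuous_snd)
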